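/- Let $G$ be a groupoid (a small category in which every arrow is invertible), with source and range maps $s,r$, whose objects are identified with their identity arrows, so that the set $G^0$ of objects is a subset of the set $G$ of arrows. Products $\gamma\rho$ are defined when $s(\gamma)=r(\rho)$. Suppose that $G$ is a Polish groupoid: $G$ carries a topology that has a countable basis consisting of open sets that are Polish in the relative topology (it need not be Hausdorff), composition $\{(\gamma,\rho)\in G\times G: s(\gamma)=r(\rho)\}\to G$ and inversion $G\to G$ are continuous and open, and $G^0$ and, for every $x\in G^0$, the sets $Gx=s^{-1}(x)$ and $xG=r^{-1}(x)$ are Polish spaces in the subspace topology. Give $G$ the $\sigma$-algebra generated by its open sets. An action of $G$ on a set $X$ consists of an anchor map $p:X\to G^0$ and a map $G\ltimes X=\{(\gamma,x)\in G\times X:s(\gamma)=p(x)\}\to X$, $(\gamma,x)\mapsto\gamma x$, such that $p(\gamma x)=r(\gamma)$, $\gamma(\rho x)=(\gamma\rho)x$ and $p(x)x=x$ whenever these expressions are defined. A Borel $G$-space is a standard Borel space $X$ with an action of $G$ such that $p$ and $(\gamma,x)\mapsto\gamma x$ are Borel; a Polish $G$-space is a Polish space $X$ with an action of $G$ such that both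 maps are continuous (here $G\ltimes X$ has the Borel structure, respectively the topology, induced from $G\times X$). A Borel $G$-isomorphism between $G$-spaces $X$ and $Y$ is a bijective Borel map $\varphi:X\to Y$ such that $p_Y\circ\varphi=p_X$ and $\varphi(\gamma x)=\gamma\varphi(x)$ for all $(\gamma,x)\in G\ltimes X$. **Theorem.** Let $G$ be a Polish groupoid. Every Borel $G$-space is Borel $G$-isomorphic to a Polish $G$-space (equipped with its Borel $\sigma$-algebra). Equivalently, for every Borel $G$-space $X$ there is a Polish topology on $X$ whose Borel $\sigma$-algebra is the given Borel structure of $X$ and for which the action of $G$ on $X$ is continuous, that is, both the anchor map and the map $(\gamma,x)\mapsto\gamma x$ are continuous. -/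

import Mathlib

open CategoryTheory

universe u v w

/-- A topological space is locally Polish if it has a countable basis of open sets that are Polish
in the relative topology. -/
def LocallyPolish (Z : Type*) [TopologicalSpace Z] : Prop :=
  ∃ B : Set (Set Z), B.Countable ∧ TopologicalSpace.IsTopologicalBasis B ∧
    ∀ U ∈ B, PolishSpace U

/- For a groupoid with type of objects `O`, the set `G` of all arrows is `Quiver.Total O`; the source
of `γ` is `γ.left` and its range is `γ.right`. -/

namespace GroupoidArrow

variable {O : Type*} [Groupoid O]

/-- The identity arrow of an object. Objects are identified with their identity arrows, so that the
set `G⁰` of objects, as a subset of the set of arrows, is `Set.range unit`. -/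
def unit (x : O) : Quiver.Total O := ⟨x, x, 𝟙 x⟩

/-- The product `γ ρ` (first `ρ`, then `γ`), defined if the source of `γ` is the range of `ρ`. -/
def mul (γ ρ : Quiver.Total O) (h : γ.left = ρ.right) : Quiver.Total O :=
  ⟨ρ.left, γ.right, ρ.hom ≫ eqToHom h.symm ≫ γ.hom⟩

/-- The inverse arrow. -/
def inv (γ : Quiver.Total O) : Quiver.Total O := ⟨γ.right, γ.left, Groupoid.inv γ.hom⟩

end GroupoidArrow

/-- The set `G²` of composable pairs of arrows. -/
abbrev ComposablePairs (O : Type*) [Groupoid O] : Type _ :=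
  {q : Quiver.Total O × Quiver.Total O // q.1.left = q.2.right}

/-- A Polish groupoid: a groupoid whose set of arrows carries a locally Polish topology such that
composition (on the subspace `G²` of `G × G`) and inversion are continuous and open, the set of
objects is Polish in the subspace topology, and so are the sets `Gx` and `xG` of arrows with source
`x`, respectively range `x`, for every object `x`. -/
class PolishGroupoid (O : Type*) [Groupoid O] [TopologicalSpace (Quiver.Total O)] : Prop where
  locallyPolish : LocallyPolish (Quiver.Total O)
  continuous_mul : Continuous fun q : ComposablePairs O => GroupoidArrow.mul q.1.1 q.1.2 q.2
  isOpenMap_mul : IsOpenMap fun q : ComposablePairs O => GroupoidArrow.mul q.1.1 q.1.2 q.2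
  continuous_inv : Continuous (GroupoidArrow.inv : Quiver.Total O → Quiver.Total O)
  isOpenMap_inv : IsOpenMap (GroupoidArrow.inv : Quiver.Total O → Quiver.Total O)
  polish_objects : PolishSpace (Set.range (GroupoidArrow.unit : O → Quiver.Total O))
  polish_source (x : O) : PolishSpace {γ : Quiver.Total O // γ.left = x}
  polish_range (x : O) : PolishSpace {γ : Quiver.Total O // γ.right = x}

/-- An action of a groupoid on a set `X`: an anchor map `p` from `X` to the set of objects and a map
`(γ, x) ↦ γ x`, defined if the source of `γ` is `p x`, with `p (γ x) = r(γ)`,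
`γ (ρ x) = (γ ρ) x` and `p(x) x = x`. -/
structure GroupoidAction (O : Type*) [Groupoid O] (X : Type*) where
  anchor : X → O
  act : (γ : Quiver.Total O) → (x : X) → γ.left = anchor x → X
  anchor_act (γ : Quiver.Total O) (x : X) (h : γ.left = anchor x) :
    anchor (act γ x h) = γ.right
  act_act (γ ρ : Quiver.Total O) (x : X) (hρ : ρ.left = anchor x) (hγ : γ.left = ρ.right) :
    act γ (act ρ x hρ) (hγ.trans (anchor_act ρ x hρ).symm) =
      act (GroupoidArrow.mul γ ρ hγ) x hρ
  unit_act (x : X) : act (GroupoidArrow.unit (anchor x)) x rfl = x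

namespace GroupoidAction

variable {O : Type*} [Groupoid O] {X Y : Type*}

/-- The domain `G ⋉ X = {(γ, x) : s(γ) = p(x)}` of the action map; as a subset of `G × X` it carries
the relative topology and the relative Borel structure. -/
abbrev Domain (a : GroupoidAction O X) : Type _ :=
  {q : Quiver.Total O × X // q.1.left = a.anchor q.2}

/-- `X` with the action `a` is a Borel `G`-space: `X` is a standard Borel space, and the anchor map
`X → G⁰ ⊆ G` and the action map `G ⋉ X → X` are Borel. -/
structure IsBorelGSpace [MeasurableSpace (Quiver.Total O)] [MeasurableSpace X]
    (a : GroupoidAction O X) : Prop where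
  standardBorel : StandardBorelSpace X
  measurable_anchor : Measurable fun x : X => GroupoidArrow.unit (a.anchor x)
  measurable_act : Measurable fun q : a.Domain => a.act q.1.1 q.1.2 q.2

/-- `X` with the action `a` is a Polish `G`-space: `X` is a Polish space, and the anchor map
`X → G⁰ ⊆ G` and the action map `G ⋉ X → X` are continuous. -/
structure IsPolishGSpace [TopologicalSpace (Quiver.Total O)] [TopologicalSpace X]
    (a : GroupoidAction O X) : Prop where
  polish : PolishSpace X
  continuous_anchor : Continuous fun x : X => GroupoidArrow.unit (a.anchor x)
  continuous_act : Continuous fun q : a.Domain => a.act q.1.1 q.1.2 q.2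

/-- A Borel `G`-isomorphism: a bijective Borel map that commutes with the anchor maps and is
`G`-equivariant. -/
structure IsBorelGIso [MeasurableSpace X] [MeasurableSpace Y] (a : GroupoidAction O X)
    (b : GroupoidAction O Y) (φ : X → Y) : Prop where
  measurable : Measurable φ
  anchor_eq (x : X) : b.anchor (φ x) = a.anchor x
  equivariant (γ : Quiver.Total O) (x : X) (h : γ.left = a.anchor x) :
    φ (a.act γ x h) = b.act γ (φ x) (h.trans (anchor_eq x).symm)
  bijective : Function.Bijective φ

end GroupoidAction

/-! This is the Becker–Kechris argument. For open `U` and Borel `B`, the Vaught transform `a.vaught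
U B` collects the `x` with `γ x ∈ B` for non-meagrely many `γ ∈ U` over `p x`. Category quantifiers
preserve Borel sets, so there is a countable Boolean algebra `A` of Borel sets, closed under
transforms at basic open sets, that generates a Polish topology. The required topology is the
coarser one generated by the transforms of members of `A`.

The action is continuous because right translation is a homeomorphism of source fibres
(`act_mem_vaught_iff`, `exists_isOpen_act_mem_vaught`). Localising Borel sets by the Baire property
gives T₀ and regularity. To get Polishness, let `vaughtCore` be the set of points generic for `A`
along their orbit near the unit. It is closed in the topology of `A`, and `a.vaught U⁻¹ B = U · (B ∩
vaughtCore)`. Hence `(γ, y) ↦ γ y`, with `y` in the core, is a continuous open surjection from a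
Polish space, and `PolishSpace.of_isOpenMap` applies. Lusin–Souslin shows that the Borel structure
is unchanged. -/

open Set hiding unit
open Topology TopologicalSpace Filter

/-! ### Polish spaces, Borel algebras and Baire category. -/

/-- A `Gδ` subset of a Polish space is Polish. -/
theorem IsGδ.polishSpace {α : Type*} [TopologicalSpace α] [PolishSpace α] {s : Set α}
    (hs : IsGδ s) : PolishSpace s := by
  obtain ⟨U, hU, rfl⟩ := isGδ_iff_eq_iInter_nat.1 hs
  have hpol : ∀ n, PolishSpace (U n) := fun n => (hU n).polishSpace
  -- The intersection is homeomorphic to the diagonal of `∏ U n`, which is closed.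
  have hcl : IsClosed {f : ∀ n, U n | ∀ n, (f n : α) = f 0} := by
    simp only [ofPred_forall]
    exact isClosed_iInter fun n => isClosed_eq (by fun_prop) (by fun_prop)
  have := hcl.polishSpace
  have h0 : Continuous fun f : ∀ n, U n => (f 0 : α) :=
    continuous_subtype_val.comp (continuous_apply 0)
  let e : (⋂ n, U n : Set α) ≃ₜ {f : ∀ n, U n | ∀ n, (f n : α) = f 0} :=
    { toFun := fun x => ⟨fun n => ⟨x.1, mem_iInter.1 x.2 n⟩, fun _ => rfl⟩
      invFun := fun f => ⟨f.1 0, mem_iInter.2 fun n => f.2 n ▸ (f.1 n).2⟩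
      left_inv := fun _ => rfl
      right_inv := fun f => by
        ext n
        exact (f.2 n).symm
      continuous_toFun := by fun_prop
      continuous_invFun := (h0.comp continuous_subtype_val).subtype_mk _ }
  exact e.isClosedEmbedding.polishSpace

/-- A regular `T₀` continuous open image of a Polish space is Polish. -/
theorem PolishSpace.of_isOpenMap {P X : Type*} [TopologicalSpace P] [PolishSpace P]
    [TopologicalSpace X] [RegularSpace X] [T0Space X] {f : P → X}
    (hf : Continuous f) (ho : IsOpenMap f)
    (hs : Function.Surjective f) : PolishSpace X := by
  have hX : SecondCountableTopology X := (ho.isQuotientMap hf hs).secondCountableTopology ho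
  have : T3Space X := {}
  let := upgradeIsCompletelyMetrizable P
  let := metrizableSpaceMetric X
  let Z := UniformSpace.Completion X
  have hsep : SeparableSpace Z := (UniformSpace.Completion.denseRange_coe).separableSpace
    (UniformSpace.Completion.continuous_coe X)
  have hZ2 : SecondCountableTopology Z := UniformSpace.secondCountable_of_separable Z
  have hZ : PolishSpace Z := inferInstance
  -- `E V` is the largest open subset of the completion whose trace on `X` lies in `f '' V`; for
  -- open `V` the trace is all of `f '' V`.
  let E : Set P → Set Z := fun V => ⋃₀ {W | IsOpen W ∧ ∀ x : X, (x : Z) ∈ W → x ∈ f '' V}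
  have hEo : ∀ V, IsOpen (E V) := fun V => isOpen_sUnion fun W hW => hW.1
  have hE : ∀ V (x : X), (x : Z) ∈ E V → x ∈ f '' V := by
    rintro V x ⟨W, hW, hx⟩
    exact hW.2 x hx
  have hE' : ∀ V, IsOpen V → ∀ p ∈ V, (f p : Z) ∈ E V := by
    intro V hV p hp
    obtain ⟨W, hW, hWV⟩ :=
      (UniformSpace.Completion.isUniformInducing_coe X).isInducing.isOpen_iff.1 (ho V hV)
    refine ⟨W, ⟨hW, fun x hx => ?_⟩, ?_⟩
    · rw [← hWV]; exact hx
    · have : f p ∈ f '' V := ⟨p, hp, rfl⟩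
      rw [← hWV] at this; exact this
  obtain ⟨b, hbc, -, hb⟩ := exists_countable_basis P
  -- `univ` is added to start the recursion below.
  let b' := insert univ b
  have hb'c : b'.Countable := hbc.insert _
  have hb'o : ∀ V ∈ b', IsOpen V := by
    rintro V (rfl | hV)
    exacts [isOpen_univ, hb.isOpen hV]
  let small : Set P → ℕ → Set (Set P) := fun V n =>
    {V' | V' ∈ b' ∧ closure V' ⊆ V ∧ ∃ c, V' ⊆ Metric.ball c (1 / ((n : ℝ) + 1))}
  -- `z ∈ S` means that one can always shrink: if `z ∈ E V`, then `z ∈ E V'` for a smaller `V'` with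
  -- closure inside `V`. Iterating this produces a point of `P` that `f` sends to `z`.
  let S : Set Z := ⋂ V ∈ b', ⋂ n : ℕ, ((E V)ᶜ ∪ ⋃ V' ∈ small V n, E V')
  have hSG : IsGδ S := by
    refine IsGδ.biInter hb'c fun V _ => IsGδ.iInter fun n => ?_
    exact (hEo V).isClosed_compl.isGδ.union
      (isOpen_biUnion fun V' _ => hEo V').isGδ
  have hmem : ∀ z, z ∈ S ↔ ∀ V ∈ b', ∀ n, z ∈ E V → ∃ V' ∈ small V n, z ∈ E V' := by
    intro z
    simp only [S, mem_iInter, mem_union, mem_compl_iff, mem_iUnion, exists_prop, imp_iff_not_or]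
  have hrange : range ((↑) : X → Z) = S := by
    apply Subset.antisymm
    · rintro _ ⟨x, rfl⟩
      rw [hmem]
      intro V hV n hx
      obtain ⟨p, hp, rfl⟩ := hE V x hx
      obtain ⟨K, hK, hKc, hKV⟩ := exists_mem_nhds_isClosed_subset
        (inter_mem ((hb'o V hV).mem_nhds hp)
          (Metric.ball_mem_nhds p (Nat.one_div_pos_of_nat (n := n) (α := ℝ))))
      obtain ⟨V', hV', hpV', hV'K⟩ := hb.mem_nhds_iff.1 hK
      refine ⟨V', ⟨Or.inr hV', ?_, p, ?_⟩, hE' V' (hb.isOpen hV') p hpV'⟩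
      · exact (closure_minimal hV'K hKc).trans (hKV.trans inter_subset_left)
      · exact hV'K.trans (hKV.trans inter_subset_right)
    · intro z hz
      rw [hmem] at hz
      have hz0 : z ∈ E univ := ⟨univ, ⟨isOpen_univ, fun x _ => by simpa using hs x⟩, trivial⟩
      choose! next hnext hnextE using hz
      let V : ℕ → Set P := fun n => n.rec univ fun k W => next W k
      have hV : ∀ n, V n ∈ b' ∧ z ∈ E (V n) := by
        intro n
        induction n with
        | zero => exact ⟨Or.inl rfl, hz0⟩
        | succ k ih => exact ⟨(hnext _ ih.1 k ih.2).1, hnextE _ ih.1 k ih.2⟩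
      have hVs : ∀ n, V (n + 1) ∈ small (V n) n := fun n => hnext _ (hV n).1 n (hV n).2
      have hanti : Antitone V := antitone_nat_of_succ_le fun n =>
        subset_closure.trans (hVs n).2.1
      have hmeet : ∀ n, ∀ ε > 0, ∃ q ∈ V n, dist z (f q : Z) < ε := by
        intro n ε hε
        obtain ⟨x, hx⟩ := UniformSpace.Completion.denseRange_coe.exists_mem_open
          ((hEo (V n)).inter Metric.isOpen_ball) ⟨z, (hV n).2, Metric.mem_ball_self hε⟩
        obtain ⟨q, hq, rfl⟩ := hE _ _ hx.1
        exact ⟨q, hq, by rw [dist_comm]; exact hx.2⟩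
      choose c hc using fun n => (hVs n).2.2
      choose q hq _ using fun n => hmeet n 1 one_pos
      have hsm : ∀ ε > (0 : ℝ), ∃ n, ∀ x ∈ V n, ∀ y ∈ V n, dist x y < ε := by
        intro ε hε
        obtain ⟨n, hn⟩ := exists_nat_one_div_lt (half_pos hε)
        refine ⟨n + 1, fun x hx y hy => ?_⟩
        have h1 := hc n hx
        have h2 := hc n hy
        rw [Metric.mem_ball] at h1 h2
        have := dist_triangle_right x y (c n)
        linarith
      have hcau : CauchySeq q := by
        rw [Metric.cauchySeq_iff']
        intro ε hε
        obtain ⟨n, hn⟩ := hsm ε hε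
        exact ⟨n, fun m hm => hn _ (hanti hm (hq m)) _ (hq n)⟩
      obtain ⟨p, hp⟩ := cauchySeq_tendsto_of_complete hcau
      have hpV : ∀ n, p ∈ V n := fun n => (hVs n).2.1 <|
        mem_closure_of_tendsto hp <| eventually_atTop.2 ⟨n + 1, fun m hm => hanti hm (hq m)⟩
      refine ⟨f p, (eq_of_forall_dist_le fun ε hε => ?_).symm⟩
      obtain ⟨δ, hδ, hδf⟩ := Metric.continuous_iff.1 hf p (ε / 2) (half_pos hε)
      obtain ⟨n, hn⟩ := hsm δ hδ
      obtain ⟨y, hy, hyz⟩ := hmeet n (ε / 2) (half_pos hε)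
      have h1 := hδf y (hn y hy p (hpV n))
      have h2 : dist (f y : Z) (f p : Z) = dist (f y) (f p) :=
        UniformSpace.Completion.dist_eq _ _
      have := dist_triangle z (f y : Z) (f p : Z)
      linarith
  have hpol : PolishSpace (range ((↑) : X → Z)) := hrange ▸ hSG.polishSpace
  exact (UniformSpace.Completion.isUniformEmbedding_coe
    X).isEmbedding.toHomeomorph.isClosedEmbedding.polishSpace

/-- Regularity can be checked on a subbasis. -/
theorem RegularSpace.of_generateFrom {X : Type*} {S : Set (Set X)}
    (h : ∀ s ∈ S, ∀ x ∈ s, ∃ t, t ∈ @nhds X (generateFrom S) x ∧ IsClosed[generateFrom S] t ∧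
      t ⊆ s) : @RegularSpace X (generateFrom S) := by
  let := generateFrom S
  refine .of_exists_mem_nhds_isClosed_subset fun x s hs => ?_
  obtain ⟨W, hWs, hW, hx⟩ := mem_nhds_iff.1 hs
  suffices ∀ W, GenerateOpen S W → ∀ x ∈ W, ∃ t ∈ 𝓝 x, IsClosed t ∧ t ⊆ W by
    obtain ⟨t, ht, htc, htW⟩ := this W hW x hx
    exact ⟨t, ht, htc, htW.trans hWs⟩
  intro W hW
  induction hW with
  | basic s hs => exact h s hs
  | univ => exact fun x _ => ⟨univ, univ_mem, isClosed_univ, Subset.rfl⟩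
  | inter s t _ _ hs ht =>
    rintro x ⟨hxs, hxt⟩
    obtain ⟨s', h1, h2, h3⟩ := hs x hxs
    obtain ⟨t', h4, h5, h6⟩ := ht x hxt
    exact ⟨s' ∩ t', inter_mem h1 h4, h2.inter h5, inter_subset_inter h3 h6⟩
  | sUnion T _ hT =>
    rintro x ⟨s, hs, hxs⟩
    obtain ⟨s', h1, h2, h3⟩ := hT s hs x hxs
    exact ⟨s', h1, h2, h3.trans (subset_sUnion_of_mem hs)⟩

/-- Refine the topology to a Polish one in which the members of `C` are open and add a countable
basis to `C`. Comparable Polish topologies have the same Borel sets, so the new members remain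
measurable. -/
theorem exists_countable_superset_polish {X : Type*} [MeasurableSpace X] [StandardBorelSpace X]
    (C : Set (Set X)) (hC : C.Countable) (hCm : ∀ s ∈ C, MeasurableSet s) :
    ∃ D, C ⊆ D ∧ D.Countable ∧ (∀ s ∈ D, MeasurableSet s) ∧
      @PolishSpace X (generateFrom D) := by
  obtain ⟨t, hb, hp⟩ := StandardBorelSpace.polish (α := X)
  have := hC.to_subtype
  choose m hmt hm _ hmo using fun s : C => (hCm s s.2).isClopenable
  obtain ⟨t', hm', ht't, ht'⟩ := PolishSpace.exists_polishSpace_forall_le m hmt hm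
  obtain ⟨b, hbc, -, hbb⟩ := @exists_countable_basis X t' _
  have hDo : ∀ s ∈ b ∪ C, IsOpen[t'] s := by
    rintro s (hs | hs)
    · exact @IsTopologicalBasis.isOpen X t' _ _ hbb hs
    · exact hm' ⟨s, hs⟩ _ (hmo ⟨s, hs⟩)
  have hgen : generateFrom (b ∪ C) = t' := by
    apply le_antisymm
    · conv_rhs => rw [hbb.eq_generateFrom]
      exact generateFrom_anti subset_union_left
    · exact le_generateFrom hDo
  refine ⟨b ∪ C, subset_union_right, hbc.union hC, fun s hs => ?_, hgen ▸ ht'⟩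
  rw [hb.measurable_eq, ← MeasureTheory.borel_eq_borel_of_le ht' hp ht't]
  exact MeasurableSpace.measurableSet_generateFrom (hDo s hs)

/-- In a standard Borel space, there are countable algebras of measurable sets that generate a
Polish topology and are closed under countably many given operations. -/
theorem exists_countable_algebra_polish {X ι : Type*} [MeasurableSpace X] [StandardBorelSpace X]
    [Countable ι] (F : ι → Set X → Set X)
    (hF : ∀ i s, MeasurableSet s → MeasurableSet (F i s)) :
    ∃ A : Set (Set X), A.Countable ∧ (∀ s ∈ A, MeasurableSet s) ∧ univ ∈ A ∧
      (∀ s ∈ A, sᶜ ∈ A) ∧ (∀ s ∈ A, ∀ t ∈ A, s ∩ t ∈ A) ∧ (∀ i, ∀ s ∈ A, F i s ∈ A) ∧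
      @PolishSpace X (generateFrom A) := by
  choose! D hCD hDc hDm hDp using
    fun (C : Set (Set X)) (h : C.Countable ∧ ∀ s ∈ C, MeasurableSet s) =>
      exists_countable_superset_polish C h.1 h.2
  let op : Set (Set X) → Set (Set X) := fun C =>
    C ∪ (compl '' C ∪ (image2 (· ∩ ·) C C ∪ ⋃ i, F i '' C))
  have hop : ∀ C : Set (Set X), C.Countable ∧ (∀ s ∈ C, MeasurableSet s) →
      (op C).Countable ∧ ∀ s ∈ op C, MeasurableSet s := by
    rintro C ⟨hc, hm⟩
    refine ⟨hc.union ((hc.image _).union ((hc.image2 hc _).union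
      (countable_iUnion fun i => hc.image _))), ?_⟩
    rintro s (hs | ⟨s, hs, rfl⟩ | ⟨s, hs, t, ht, rfl⟩ | hs)
    · exact hm s hs
    · exact (hm s hs).compl
    · exact (hm s hs).inter (hm t ht)
    · obtain ⟨i, s', hs', rfl⟩ := mem_iUnion.1 hs
      exact hF i s' (hm s' hs')
  -- Closing under the operations and enlarging to generate a Polish topology alternate. In the
  -- limit both hold, since a countable join of Polish topologies refining a common one of them is
  -- Polish.
  let A : ℕ → Set (Set X) := fun n => n.rec (D {univ}) fun _ C => D (op C)
  have h0 : ({univ} : Set (Set X)).Countable ∧ ∀ s ∈ ({univ} : Set (Set X)), MeasurableSet s :=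
    ⟨countable_singleton _, fun s hs => by rw [mem_singleton_iff.1 hs]; exact .univ⟩
  have hA : ∀ n, (A n).Countable ∧ ∀ s ∈ A n, MeasurableSet s := by
    intro n
    induction n with
    | zero => exact ⟨hDc _ h0, hDm _ h0⟩
    | succ k ih => exact ⟨hDc _ (hop _ ih), hDm _ (hop _ ih)⟩
  have hAp : ∀ n, @PolishSpace X (generateFrom (A n)) := by
    rintro (_ | k)
    exacts [hDp _ h0, hDp _ (hop _ (hA k))]
  have hsucc : ∀ n, op (A n) ⊆ A (n + 1) := fun n => hCD _ (hop _ (hA n))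
  have hmono : Monotone A := monotone_nat_of_le_succ fun n => subset_union_left.trans (hsucc n)
  refine ⟨⋃ n, A n, countable_iUnion fun n => (hA n).1, ?_, mem_iUnion.2 ⟨0, hCD _ h0 rfl⟩,
    ?_, ?_, ?_, ?_⟩
  · intro s hs
    obtain ⟨n, hn⟩ := mem_iUnion.1 hs
    exact (hA n).2 s hn
  · intro s hs
    obtain ⟨n, hn⟩ := mem_iUnion.1 hs
    exact mem_iUnion.2 ⟨n + 1, hsucc n (Or.inr (Or.inl ⟨s, hn, rfl⟩))⟩
  · intro s hs t ht
    obtain ⟨n, hn⟩ := mem_iUnion.1 hs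
    obtain ⟨k, hk⟩ := mem_iUnion.1 ht
    exact mem_iUnion.2 ⟨max n k + 1, hsucc _ (Or.inr (Or.inr (Or.inl
      ⟨s, hmono (le_max_left _ _) hn, t, hmono (le_max_right _ _) hk, rfl⟩)))⟩
  · intro i s hs
    obtain ⟨n, hn⟩ := mem_iUnion.1 hs
    exact mem_iUnion.2 ⟨n + 1, hsucc n (Or.inr (Or.inr (Or.inr
      (mem_iUnion.2 ⟨i, s, hn, rfl⟩))))⟩
  · have : generateFrom (⋃ n, A n) = ⨅ n, generateFrom (A n) := generateFrom_iUnion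
    rw [this]
    exact PolishSpace.iInf ⟨0, fun n => generateFrom_anti (hmono (Nat.zero_le n))⟩ hAp

theorem IsMeagre.of_forall_mem {Z : Type*} [TopologicalSpace Z] {S T : Set Z} (hS : IsMeagre S)
    (h : ∀ z ∈ T, z ∈ S) : IsMeagre T :=
  hS.mono h

/-- By the Baire property `U ∩ S` is an open set modulo a meagre set; if that open set missed `U`,
then `U ∩ S` would be meagre. -/
theorem exists_isOpen_isMeagre_diff {Z : Type*} [TopologicalSpace Z] [BaireSpace Z]
    [MeasurableSpace Z] [BorelSpace Z] {U S : Set Z} (hU : IsOpen U) (hS : MeasurableSet S)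
    (h : ¬IsMeagre (U ∩ S)) : ∃ V ⊆ U, IsOpen V ∧ V.Nonempty ∧ IsMeagre (V \ S) := by
  obtain ⟨V, hV, hVS⟩ := (hU.measurableSet.inter hS).residualEq_isOpen
  have hd : IsMeagre (V \ (U ∩ S)) := by
    filter_upwards [hVS] with z hz hz'
    exact hz'.2 ((eq_iff_iff.1 hz).2 hz'.1)
  have hd' : IsMeagre ((U ∩ S) \ V) := by
    filter_upwards [hVS] with z hz hz'
    exact hz'.2 ((eq_iff_iff.1 hz).1 hz'.1)
  refine ⟨V ∩ U, inter_subset_right, hV.inter hU, ?_,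
    hd.of_forall_mem fun z hz => ⟨hz.1.1, fun h => hz.2 h.2⟩⟩
  by_contra hne
  rw [not_nonempty_iff_eq_empty] at hne
  refine h (hd'.of_forall_mem fun z hz => ⟨hz, fun hzV => ?_⟩)
  exact (hne ▸ ⟨hzV, hz.1⟩ : z ∈ (∅ : Set Z))

theorem Homeomorph.isMeagre_preimage_iff {Y Z : Type*} [TopologicalSpace Y] [TopologicalSpace Z]
    (e : Y ≃ₜ Z) {S : Set Z} : IsMeagre (e ⁻¹' S) ↔ IsMeagre S := by
  refine ⟨fun h => ?_, IsMeagre.preimage_of_isOpenMap e.continuous e.isOpenMap⟩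
  have := IsMeagre.preimage_of_isOpenMap e.symm.continuous e.symm.isOpenMap h
  rwa [← preimage_comp, e.self_comp_symm, preimage_id] at this

/-! ### Algebra and topology of the arrows. -/

namespace GroupoidArrow

variable {O : Type*} [Groupoid O]

/-- The arrows with source `o`. -/
abbrev Source (o : O) : Type _ := {γ : Quiver.Total O // γ.left = o}

theorem unit_injective : Function.Injective (unit : O → Quiver.Total O) :=
  fun _ _ h => congrArg Quiver.Total.left h

theorem mul_assoc (α β γ : Quiver.Total O) (h : α.left = β.right) (h' : β.left = γ.right) :
    mul (mul α β h) γ h' = mul α (mul β γ h') h := by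
  obtain ⟨a, b, f⟩ := α
  obtain ⟨c, d, g⟩ := β
  obtain ⟨e, i, k⟩ := γ
  dsimp only at h h'
  subst h h'
  simp only [mul, Category.assoc, eqToHom_refl, Category.id_comp, Quiver.Total.mk.injEq, heq_eq_eq,
    true_and]
  exact congrArg (k ≫ ·) ((Category.id_comp _).trans (congrArg (g ≫ ·) (Category.id_comp _).symm))

theorem inv_left (γ : Quiver.Total O) : (inv γ).left = γ.right := rfl

theorem inv_right (γ : Quiver.Total O) : (inv γ).right = γ.left := rfl

theorem mul_inv (γ : Quiver.Total O) (h : γ.left = (inv γ).right) :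
    mul γ (inv γ) h = unit γ.right := by
  obtain ⟨a, b, f⟩ := γ
  simp only [mul, inv, unit, Groupoid.inv_eq_inv, Quiver.Total.mk.injEq, heq_eq_eq, true_and]
  exact (congrArg (CategoryTheory.inv f ≫ ·) (Category.id_comp _)).trans (IsIso.inv_hom_id f)

theorem inv_mul (γ : Quiver.Total O) (h : (inv γ).left = γ.right) :
    mul (inv γ) γ h = unit γ.left := by
  obtain ⟨a, b, f⟩ := γ
  simp only [mul, inv, unit, Groupoid.inv_eq_inv, Quiver.Total.mk.injEq, heq_eq_eq, true_and]
  exact (congrArg (f ≫ ·) (Category.id_comp _)).trans (IsIso.hom_inv_id f)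

theorem mul_unit (γ : Quiver.Total O) (o : O) (h : γ.left = o) : mul γ (unit o) h = γ := by
  obtain ⟨a, b, f⟩ := γ
  dsimp only at h
  subst h
  simp [mul, unit]

theorem unit_mul (γ : Quiver.Total O) (o : O) (h : o = γ.right) : mul (unit o) γ h = γ := by
  obtain ⟨a, b, f⟩ := γ
  dsimp only at h
  subst h
  simp only [mul, unit, Quiver.Total.mk.injEq, heq_eq_eq, true_and, Category.comp_id]
  exact Category.comp_id f

theorem inv_inv (γ : Quiver.Total O) : inv (inv γ) = γ := by
  obtain ⟨a, b, f⟩ := γ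
  simp [inv]

theorem inv_unit (o : O) : inv (unit o) = unit o := by
  simp [inv, unit]

theorem mul_congr {α α' β β' : Quiver.Total O} (hα : α = α') (hβ : β = β')
    (h : α.left = β.right) : mul α β h = mul α' β' (hα ▸ hβ ▸ h) := by
  subst hα hβ
  rfl

theorem mul_inv_cancel_right (α β : Quiver.Total O) (h : α.left = β.right)
    (h' : (mul α β h).left = (inv β).right) : mul (mul α β h) (inv β) h' = α :=
  (mul_assoc α β (inv β) h h').trans ((mul_congr rfl (mul_inv β h') h).trans (mul_unit α _ h))

theorem inv_mul_cancel_right (α β : Quiver.Total O) (h : α.left = (inv β).right)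
    (h' : (mul α (inv β) h).left = β.right) : mul (mul α (inv β) h) β h' = α :=
  (mul_assoc α (inv β) β h h').trans ((mul_congr rfl (inv_mul β h') h).trans (mul_unit α _ h))

/-- `α = (α β⁻¹) β`. -/
theorem mem_of_mul_inv_mem {U V W : Set (Quiver.Total O)}
    (hU : ∀ α ∈ V, ∀ β ∈ W, ∀ h : α.left = β.right, mul α β h ∈ U) {α β : Quiver.Total O}
    (h : α.left = (inv β).right) (hα : mul α (inv β) h ∈ V) (hβ : β ∈ W) : α ∈ U :=
  inv_mul_cancel_right α β h rfl ▸ hU _ hα β hβ rfl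

variable [TopologicalSpace (Quiver.Total O)] [PolishGroupoid O]

instance (o : O) : PolishSpace (Source o) := PolishGroupoid.polish_source o

theorem continuous_inv : Continuous (inv : Quiver.Total O → Quiver.Total O) :=
  PolishGroupoid.continuous_inv

theorem _root_.Continuous.groupoid_mul {Z : Type*} [TopologicalSpace Z] {f g : Z → Quiver.Total O}
    (hf : Continuous f) (hg : Continuous g) (h : ∀ z, (f z).left = (g z).right) :
    Continuous fun z => mul (f z) (g z) (h z) :=
  PolishGroupoid.continuous_mul.comp ((hf.prodMk hg).subtype_mk h)

theorem continuous_unit_left : Continuous fun γ : Quiver.Total O => unit γ.left := by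
  simp_rw [← fun γ : Quiver.Total O => inv_mul γ (inv_left γ)]
  exact continuous_inv.groupoid_mul continuous_id _

theorem continuous_unit_right : Continuous fun γ : Quiver.Total O => unit γ.right := by
  simp_rw [← fun γ : Quiver.Total O => mul_inv γ (inv_right γ).symm]
  exact continuous_id.groupoid_mul continuous_inv _

theorem exists_isOpen_mul_mem {α β : Quiver.Total O} (h : α.left = β.right)
    {U : Set (Quiver.Total O)} (hU : IsOpen U) (hm : mul α β h ∈ U) :
    ∃ V W, IsOpen V ∧ IsOpen W ∧ α ∈ V ∧ β ∈ W ∧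
      ∀ α' ∈ V, ∀ β' ∈ W, ∀ h' : α'.left = β'.right, mul α' β' h' ∈ U := by
  obtain ⟨N, hN, hNU⟩ := isOpen_induced_iff.1 (hU.preimage PolishGroupoid.continuous_mul)
  have hαβ : (⟨(α, β), h⟩ : ComposablePairs O) ∈ Subtype.val ⁻¹' N := hNU ▸ hm
  obtain ⟨V, W, hV, hW, hα, hβ, hVW⟩ := isOpen_prod_iff.1 hN α β hαβ
  refine ⟨V, W, hV, hW, hα, hβ, fun α' hα' β' hβ' h' => ?_⟩
  have : (⟨(α', β'), h'⟩ : ComposablePairs O) ∈ Subtype.val ⁻¹' N := hVW ⟨hα', hβ'⟩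
  rw [hNU] at this
  exact this

/-- The source map is open. -/
theorem exists_isOpen_unit_mem_iff {W : Set (Quiver.Total O)} (hW : IsOpen W) :
    ∃ W' : Set (Quiver.Total O), IsOpen W' ∧ ∀ o, unit o ∈ W' ↔ ∃ γ ∈ W, γ.left = o := by
  -- The witness is the set of products with right factor in `W`: their sources are sources of
  -- arrows in `W`, and it contains `γ⁻¹ γ` for `γ ∈ W`.
  refine ⟨_, PolishGroupoid.isOpenMap_mul _
    (hW.preimage (continuous_snd.comp continuous_subtype_val)), fun o => ⟨?_, ?_⟩⟩
  · rintro ⟨q, hq, h⟩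
    exact ⟨_, hq, congrArg Quiver.Total.left h⟩
  · rintro ⟨γ, hγ, rfl⟩
    exact ⟨⟨(inv γ, γ), rfl⟩, hγ, inv_mul γ rfl⟩

/-- Right translation by an arrow. -/
def rightMul (ρ : Quiver.Total O) {o o' : O} (h : ρ.left = o) (h' : ρ.right = o') :
    Source o' ≃ₜ Source o where
  toFun σ := ⟨mul σ.1 ρ (σ.2.trans h'.symm), h⟩
  invFun σ := ⟨mul σ.1 (inv ρ) (σ.2.trans h.symm), h'⟩
  left_inv σ := Subtype.ext (mul_inv_cancel_right σ.1 ρ (σ.2.trans h'.symm) rfl)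
  right_inv σ := Subtype.ext (inv_mul_cancel_right σ.1 ρ (σ.2.trans h.symm) rfl)
  continuous_toFun := (continuous_subtype_val.groupoid_mul continuous_const _).subtype_mk _
  continuous_invFun := (continuous_subtype_val.groupoid_mul continuous_const _).subtype_mk _

theorem not_isMeagre_of_mem {o : O} {U : Set (Quiver.Total O)} (hU : IsOpen U) {γ : Source o}
    (hγ : γ.1 ∈ U) : ¬IsMeagre {γ : Source o | γ.1 ∈ U} :=
  not_isMeagre_of_isOpen (hU.preimage continuous_subtype_val) ⟨γ, hγ⟩

theorem exists_mem_basis_isMeagre [MeasurableSpace (Quiver.Total O)] [BorelSpace (Quiver.Total O)]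
    {𝓤 : Set (Set (Quiver.Total O))} (h𝓤 : IsTopologicalBasis 𝓤) {o : O}
    {U : Set (Quiver.Total O)} (hU : IsOpen U) {S : Set (Source o)} (hS : MeasurableSet S)
    (h : ¬IsMeagre {γ : Source o | γ.1 ∈ U ∧ γ ∈ S}) :
    ∃ V ∈ 𝓤, V ⊆ U ∧ (∃ γ : Source o, γ.1 ∈ V) ∧ IsMeagre {γ : Source o | γ.1 ∈ V ∧ γ ∉ S} := by
  obtain ⟨V, hVU, hV, ⟨γ, hγ⟩, hm⟩ :=
    exists_isOpen_isMeagre_diff (hU.preimage continuous_subtype_val) hS h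
  obtain ⟨W, hW, rfl⟩ := isOpen_induced_iff.1 hV
  obtain ⟨V', hV', hγV', hV'W⟩ :=
    h𝓤.exists_subset_of_mem_open (show γ.1 ∈ W ∩ U from ⟨hγ, hVU hγ⟩) (hW.inter hU)
  exact ⟨V', hV', hV'W.trans inter_subset_right, ⟨γ, hγV'⟩,
    hm.of_forall_mem fun σ hσ => ⟨(hV'W hσ.1).1, hσ.2⟩⟩

end GroupoidArrow

/-! ### Vaught transforms and their measurability. -/

namespace GroupoidAction

open GroupoidArrow

variable {O : Type*} [Groupoid O] {X : Type*} (a : GroupoidAction O X)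

theorem act_congr {γ γ' : Quiver.Total O} {x x' : X} (hγ : γ = γ') (hx : x = x')
    (h : γ.left = a.anchor x) : a.act γ x h = a.act γ' x' (hγ ▸ hx ▸ h) := by
  subst hγ hx
  rfl

theorem act_inv_act {γ : Quiver.Total O} {x : X} (h : γ.left = a.anchor x) :
    a.act (inv γ) (a.act γ x h) ((inv_left γ).trans (a.anchor_act γ x h).symm) = x :=
  (a.act_act (inv γ) γ x h (inv_left γ)).trans ((a.act_congr
    ((inv_mul γ (inv_left γ)).trans (congrArg unit h)) rfl h).trans (a.unit_act x))

theorem act_injective {γ : Quiver.Total O} {x y : X} (hx : γ.left = a.anchor x)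
    (hy : γ.left = a.anchor y) (h : a.act γ x hx = a.act γ y hy) : x = y :=
  (a.act_inv_act hx).symm.trans ((a.act_congr rfl h _).trans (a.act_inv_act hy))

section Measurable

variable [MeasurableSpace (Quiver.Total O)] [MeasurableSpace X]

theorem measurableSet_section (x : X) {E : Set a.Domain} (hE : MeasurableSet E) :
    MeasurableSet {γ : Source (a.anchor x) | (⟨(γ.1, x), γ.2⟩ : a.Domain) ∈ E} :=
  ((measurable_subtype_coe.prodMk measurable_const).subtype_mk : Measurable
    fun γ : Source (a.anchor x) => (⟨(γ.1, x), γ.2⟩ : a.Domain)) hE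

variable {a} in
theorem IsBorelGSpace.measurableSet_act_mem (ha : a.IsBorelGSpace) {x : X} {o : O}
    (h : o = a.anchor x) {B : Set X} (hB : MeasurableSet B) :
    MeasurableSet {γ : Source o | a.act γ.1 x (γ.2.trans h) ∈ B} := by
  subst h
  exact measurableSet_section a x (ha.measurable_act hB)

end Measurable

variable [TopologicalSpace (Quiver.Total O)]

/-- The Vaught transform: the set of all `x` such that `γ x ∈ B` for non-meagrely many `γ ∈ U` with
source `p x`. -/
def vaught (U : Set (Quiver.Total O)) (B : Set X) : Set X :=
  {x | ¬IsMeagre {γ : Source (a.anchor x) | γ.1 ∈ U ∧ a.act γ.1 x γ.2 ∈ B}}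

theorem mem_vaught {U : Set (Quiver.Total O)} {B : Set X} {x : X} : x ∈ a.vaught U B ↔
    ¬IsMeagre {γ : Source (a.anchor x) | γ.1 ∈ U ∧ a.act γ.1 x γ.2 ∈ B} := Iff.rfl

theorem mem_vaught_iff_of_eq {U : Set (Quiver.Total O)} {B : Set X} {x : X} {o : O}
    (h : o = a.anchor x) : x ∈ a.vaught U B ↔
    ¬IsMeagre {γ : Source o | γ.1 ∈ U ∧ a.act γ.1 x (γ.2.trans h) ∈ B} := by
  subst h
  rfl

theorem vaught_mono {U U' : Set (Quiver.Total O)} {B B' : Set X} (hU : U ⊆ U') (hB : B ⊆ B') :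
    a.vaught U B ⊆ a.vaught U' B' :=
  fun _ hx h => hx (h.of_forall_mem fun _ hγ => ⟨hU hγ.1, hB hγ.2⟩)

theorem exists_mem_vaught_of_subset_sUnion {T : Set (Set (Quiver.Total O))} (hT : T.Countable)
    {U : Set (Quiver.Total O)} {B : Set X} {x : X} (hx : x ∈ a.vaught U B)
    (hU : ∀ γ ∈ U, γ.left = a.anchor x → ∃ V ∈ T, γ ∈ V) : ∃ V ∈ T, x ∈ a.vaught V B := by
  by_contra! h
  have := hT.to_subtype
  refine hx ((isMeagre_iUnion fun V : T => not_not.1 (h V V.2)).of_forall_mem fun γ hγ => ?_)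
  obtain ⟨V, hV, hγV⟩ := hU γ.1 hγ.1 γ.2
  exact mem_iUnion.2 ⟨⟨V, hV⟩, hγV, hγ.2⟩

/-- This reduces arbitrary open sets to the basic ones, under whose transforms the algebra is
closed. -/
theorem vaught_eq_biUnion {𝓤 : Set (Set (Quiver.Total O))} (hc : 𝓤.Countable)
    (h𝓤 : IsTopologicalBasis 𝓤) {U : Set (Quiver.Total O)} (hU : IsOpen U) (B : Set X) :
    a.vaught U B = ⋃ V ∈ {V ∈ 𝓤 | V ⊆ U}, a.vaught V B := by
  apply Subset.antisymm
  · intro x hx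
    obtain ⟨V, hV, hxV⟩ := a.exists_mem_vaught_of_subset_sUnion
      (hc.mono fun V (hV : V ∈ {V ∈ 𝓤 | V ⊆ U}) => hV.1) hx fun γ hγ _ => by
        obtain ⟨V, hV, hγV, hVU⟩ := h𝓤.exists_subset_of_mem_open hγ hU
        exact ⟨V, ⟨hV, hVU⟩, hγV⟩
    exact mem_biUnion hV hxV
  · exact iUnion₂_subset fun V hV => a.vaught_mono hV.2 Subset.rfl

variable [PolishGroupoid O]

/-- Right translation by `ρ` carries the fibre over `r(ρ)` homeomorphically to the one over `p x`,
so it preserves meagreness. -/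
theorem act_mem_vaught_iff {U : Set (Quiver.Total O)} {B : Set X} {ρ : Quiver.Total O} {x : X}
    (h : ρ.left = a.anchor x) : a.act ρ x h ∈ a.vaught U B ↔
    ¬IsMeagre {σ : Source (a.anchor x) |
      mul σ.1 (inv ρ) (σ.2.trans h.symm) ∈ U ∧ a.act σ.1 x σ.2 ∈ B} := by
  rw [mem_vaught, ← (rightMul ρ h (a.anchor_act ρ x h).symm).isMeagre_preimage_iff]
  refine not_congr (iff_of_eq (congrArg IsMeagre ?_))
  ext σ
  have hσ : σ.1.left = ρ.right := σ.2.trans (a.anchor_act ρ x h)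
  have h1 : mul (mul σ.1 ρ hσ) (inv ρ) rfl = σ.1 := mul_inv_cancel_right _ _ _ _
  have h2 := a.act_act σ.1 ρ x h hσ
  change _ ↔ mul (mul σ.1 ρ hσ) (inv ρ) rfl ∈ U ∧ a.act (mul σ.1 ρ hσ) x h ∈ B
  rw [h1, ← h2]
  rfl

theorem mem_vaught_univ_iff {U : Set (Quiver.Total O)} (hU : IsOpen U) {x : X} :
    x ∈ a.vaught U univ ↔ ∃ γ ∈ U, γ.left = a.anchor x := by
  constructor
  · intro h
    obtain ⟨γ, hγ⟩ := nonempty_of_not_isMeagre h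
    exact ⟨γ.1, hγ.1, γ.2⟩
  · rintro ⟨γ, hγ, h⟩ hm
    exact not_isMeagre_of_mem hU (γ := ⟨γ, h⟩) hγ (hm.of_forall_mem fun σ hσ => ⟨hσ, trivial⟩)

variable [MeasurableSpace (Quiver.Total O)] [BorelSpace (Quiver.Total O)] [MeasurableSpace X]

variable {a}

/-- The category quantifier preserves Borel sets. -/
theorem IsBorelGSpace.measurableSet_not_isMeagre_section (ha : a.IsBorelGSpace) {E : Set a.Domain}
    (hE : MeasurableSet E) {U : Set (Quiver.Total O)} (hU : IsOpen U) :
    MeasurableSet {x | ¬IsMeagre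
      {γ : Source (a.anchor x) | γ.1 ∈ U ∧ (⟨(γ.1, x), γ.2⟩ : a.Domain) ∈ E}} := by
  obtain ⟨𝓤, hc, h𝓤, -⟩ := PolishGroupoid.locallyPolish (O := O)
  have hproj : ∀ W : Set (Quiver.Total O), IsOpen W →
      MeasurableSet {x | ∃ γ ∈ W, γ.left = a.anchor x} := by
    intro W hW
    obtain ⟨W', hW', h⟩ := exists_isOpen_unit_mem_iff hW
    simp_rw [← h]
    exact ha.measurable_anchor hW'.measurableSet
  let C : Set (Set (Quiver.Total O × X)) := image2 (· ×ˢ ·) {V | IsOpen V} {B | MeasurableSet B}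
  have hC : MeasurableSpace.generateFrom C = Prod.instMeasurableSpace :=
    generateFrom_eq_prod BorelSpace.measurable_eq.symm MeasurableSpace.generateFrom_measurableSet
      ⟨fun _ => univ, fun _ => isOpen_univ, iUnion_const _⟩
      ⟨fun _ => univ, fun _ => MeasurableSet.univ, iUnion_const _⟩
  have hD : (Subtype.instMeasurableSpace : MeasurableSpace a.Domain) =
      MeasurableSpace.generateFrom (preimage Subtype.val '' C) := by
    rw [← MeasurableSpace.comap_generateFrom, hC]
    rfl
  rw [hD] at hE
  -- The complement case needs the induction hypothesis at smaller open sets.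
  revert U
  induction E, hE using MeasurableSpace.generateFrom_induction with
  | hC E hE' hE =>
    obtain ⟨_, ⟨V, hV, B, hB, rfl⟩, rfl⟩ := hE'
    intro U hU
    convert hB.inter (hproj (U ∩ V) (hU.inter hV)) using 1
    ext x
    constructor
    · intro h
      obtain ⟨γ, h1, h2, h3⟩ := nonempty_of_not_isMeagre h
      exact ⟨h3, γ.1, ⟨h1, h2⟩, γ.2⟩
    · rintro ⟨hxB, γ, hγ, h⟩ hm
      exact not_isMeagre_of_mem (hU.inter hV) (γ := ⟨γ, h⟩) hγ
        (hm.of_forall_mem fun σ hσ => ⟨hσ.1, hσ.2, hxB⟩)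
  | empty =>
    intro U hU
    convert MeasurableSet.empty (α := X) using 1
    simp [IsMeagre.empty]
  | compl E hE ih =>
    intro U hU
    rw [← hD] at hE
    -- By the Baire property, `Eᶜ` is non-meagre in `U` iff `E` is meagre in some basic `V ⊆ U` that
    -- meets the fibre.
    have : {x | ¬IsMeagre
        {γ : Source (a.anchor x) | γ.1 ∈ U ∧ (⟨(γ.1, x), γ.2⟩ : a.Domain) ∈ Eᶜ}} =
        ⋃ V ∈ {V ∈ 𝓤 | V ⊆ U}, {x | ∃ γ ∈ V, γ.left = a.anchor x} ∩ {x | ¬IsMeagre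
          {γ : Source (a.anchor x) | γ.1 ∈ V ∧ (⟨(γ.1, x), γ.2⟩ : a.Domain) ∈ E}}ᶜ := by
      ext x
      simp only [mem_iUnion, exists_prop]
      constructor
      · intro h
        obtain ⟨V, hV, hVU, ⟨γ, hγ⟩, hm⟩ := exists_mem_basis_isMeagre h𝓤 hU
          (a.measurableSet_section x hE.compl) h
        exact ⟨V, ⟨hV, hVU⟩, ⟨γ.1, hγ, γ.2⟩, fun hn => hn (hm.of_forall_mem fun σ hσ =>
          ⟨hσ.1, fun h => h hσ.2⟩)⟩
      · rintro ⟨V, ⟨hV, hVU⟩, ⟨γ, hγ, hγx⟩, hm⟩ hm'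
        refine not_isMeagre_of_mem (h𝓤.isOpen hV) (γ := ⟨γ, hγx⟩) hγ
          (((not_not.1 hm).union hm').of_forall_mem fun σ hσ => ?_)
        by_cases h : (⟨(σ.1, x), σ.2⟩ : a.Domain) ∈ E
        exacts [Or.inl ⟨hσ, h⟩, Or.inr ⟨hVU hσ, h⟩]
    rw [this]
    exact MeasurableSet.biUnion (hc.mono fun V hV => hV.1) fun V hV =>
      (hproj V (h𝓤.isOpen hV.1)).inter (ih (h𝓤.isOpen hV.1)).compl
  | iUnion E hE ih =>
    intro U hU
    convert MeasurableSet.iUnion fun n => ih n hU using 1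
    ext x
    simp only [mem_iUnion]
    constructor
    · intro h
      by_contra! hn
      refine h ((isMeagre_iUnion fun n => not_not.1 (hn n)).of_forall_mem fun γ hγ => ?_)
      obtain ⟨n, hn⟩ := hγ.2
      exact mem_iUnion.2 ⟨n, hγ.1, hn⟩
    · rintro ⟨n, hn⟩ hm
      exact hn (hm.of_forall_mem fun γ hγ => ⟨hγ.1, n, hγ.2⟩)

theorem IsBorelGSpace.measurableSet_vaught (ha : a.IsBorelGSpace) {U : Set (Quiver.Total O)}
    (hU : IsOpen U) {B : Set X} (hB : MeasurableSet B) : MeasurableSet (a.vaught U B) :=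
  ha.measurableSet_not_isMeagre_section (ha.measurable_act hB) hU

theorem IsBorelGSpace.exists_mem_basis_of_mem_vaught (ha : a.IsBorelGSpace)
    {𝓤 : Set (Set (Quiver.Total O))} (h𝓤 : IsTopologicalBasis 𝓤) {U : Set (Quiver.Total O)}
    (hU : IsOpen U) {B : Set X} (hB : MeasurableSet B) {x : X} (hx : x ∈ a.vaught U B) :
    ∃ V ∈ 𝓤, V ⊆ U ∧ (∃ γ ∈ V, γ.left = a.anchor x) ∧ x ∉ a.vaught V Bᶜ := by
  obtain ⟨V, hV, hVU, ⟨γ, hγ⟩, hm⟩ :=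
    exists_mem_basis_isMeagre h𝓤 hU (ha.measurableSet_act_mem rfl hB) hx
  exact ⟨V, hV, hVU, ⟨γ.1, hγ, γ.2⟩, fun h => h hm⟩

end GroupoidAction

/-! ### The Vaught topology and continuity of the action. -/

namespace GroupoidAction

open GroupoidArrow

variable {O : Type*} [Groupoid O] {X : Type*} (a : GroupoidAction O X)
  [TopologicalSpace (Quiver.Total O)]

/-- The topology generated by the Vaught transforms of the members of `A`. -/
@[reducible]
def vaughtTopology (A : Set (Set X)) : TopologicalSpace X :=
  generateFrom {W | ∃ U, IsOpen U ∧ ∃ B ∈ A, a.vaught U B = W}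

/-- A countable algebra of Borel sets that generates a Polish topology and is closed under Vaught
transforms. -/
structure IsVaughtAlgebra [MeasurableSpace X] (𝓤 : Set (Set (Quiver.Total O)))
    (A : Set (Set X)) : Prop where
  countable : A.Countable
  measurableSet : ∀ B ∈ A, MeasurableSet B
  univ_mem : univ ∈ A
  compl_mem : ∀ B ∈ A, Bᶜ ∈ A
  inter_mem : ∀ B ∈ A, ∀ C ∈ A, B ∩ C ∈ A
  vaught_mem : ∀ U ∈ 𝓤, ∀ B ∈ A, a.vaught U B ∈ A
  polish : @PolishSpace X (generateFrom A)

variable {a}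

theorem isOpen_vaught {A : Set (Set X)} {U : Set (Quiver.Total O)} (hU : IsOpen U) {B : Set X}
    (hB : B ∈ A) : IsOpen[a.vaughtTopology A] (a.vaught U B) :=
  isOpen_generateFrom_of_mem ⟨U, hU, B, hB, rfl⟩

theorem IsBorelGSpace.exists_isVaughtAlgebra [PolishGroupoid O]
    [MeasurableSpace (Quiver.Total O)] [BorelSpace (Quiver.Total O)] [MeasurableSpace X]
    (ha : a.IsBorelGSpace) {𝓤 : Set (Set (Quiver.Total O))} (hc : 𝓤.Countable)
    (ho : ∀ U ∈ 𝓤, IsOpen U) : ∃ A, a.IsVaughtAlgebra 𝓤 A := by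
  have := ha.standardBorel
  have := hc.to_subtype
  obtain ⟨A, h1, h2, h3, h4, h5, h6, h7⟩ := exists_countable_algebra_polish
    (fun (U : 𝓤) B => a.vaught U.1 B) fun U B hB => ha.measurableSet_vaught (ho U U.2) hB
  exact ⟨A, h1, h2, h3, h4, h5, fun U hU => h6 ⟨U, hU⟩, h7⟩

section

variable [MeasurableSpace X] {𝓤 : Set (Set (Quiver.Total O))} {A : Set (Set X)}

theorem IsVaughtAlgebra.isTopologicalBasis (hA : a.IsVaughtAlgebra 𝓤 A) :
    @IsTopologicalBasis X (generateFrom A) A := by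
  have := @isTopologicalBasis_of_subbasis_of_inter X (generateFrom A) A rfl
    fun s hs t ht => hA.inter_mem s hs t ht
  rwa [insert_eq_of_mem hA.univ_mem] at this

theorem IsVaughtAlgebra.generateFrom_le (hA : a.IsVaughtAlgebra 𝓤 A) (hc : 𝓤.Countable)
    (h𝓤 : IsTopologicalBasis 𝓤) : generateFrom A ≤ a.vaughtTopology A := by
  refine le_generateFrom ?_
  rintro _ ⟨U, hU, B, hB, rfl⟩
  rw [a.vaught_eq_biUnion hc h𝓤 hU]
  let := generateFrom A
  exact isOpen_biUnion fun V hV => isOpen_generateFrom_of_mem (hA.vaught_mem V hV.1 B hB)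

end

variable [PolishGroupoid O]

theorem continuous_anchor_vaughtTopology {A : Set (Set X)} (hA : univ ∈ A) :
    Continuous[a.vaughtTopology A, _] fun x => unit (a.anchor x) := by
  let := a.vaughtTopology A
  refine continuous_def.2 fun W hW => ?_
  -- This preimage contains each source fibre entirely or misses it.
  have hW' := hW.preimage continuous_unit_left
  convert isOpen_vaught (a := a) hW' hA using 1
  ext x
  rw [mem_vaught_univ_iff a hW']
  constructor
  · exact fun h => ⟨unit (a.anchor x), h, rfl⟩
  · rintro ⟨γ, hγ, h⟩
    rw [mem_preimage, ← h]
    exact hγ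

/-- By continuity of multiplication, `{σ | σ ρ⁻¹ ∈ U}` is covered by countably many basic `W`, each
with `W V⁻¹ ⊆ U` for some neighbourhood `V` of `ρ`. On one of these `W` the relevant set is
non-meagre. -/
theorem exists_isOpen_act_mem_vaught {U : Set (Quiver.Total O)} (hU : IsOpen U) {B : Set X}
    {ρ : Quiver.Total O} {x : X} (h : ρ.left = a.anchor x) (hx : a.act ρ x h ∈ a.vaught U B) :
    ∃ V W, IsOpen V ∧ IsOpen W ∧ ρ ∈ V ∧ x ∈ a.vaught W B ∧ ∀ ρ' ∈ V, ∀ x' ∈ a.vaught W B,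
      ∀ h' : ρ'.left = a.anchor x', a.act ρ' x' h' ∈ a.vaught U B := by
  obtain ⟨𝓤, hc, h𝓤, -⟩ := PolishGroupoid.locallyPolish (O := O)
  let T : Set (Set (Quiver.Total O)) := {W ∈ 𝓤 | ∃ V, IsOpen V ∧ ρ ∈ V ∧ ∀ σ ∈ W, ∀ ρ' ∈ V,
    ∀ h : σ.left = (inv ρ').right, mul σ (inv ρ') h ∈ U}
  have hx' : x ∈ a.vaught {σ | ∃ h : σ.left = (inv ρ).right, mul σ (inv ρ) h ∈ U} B := by
    rw [act_mem_vaught_iff] at hx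
    exact fun hm => hx (hm.of_forall_mem fun σ hσ => ⟨⟨_, hσ.1⟩, hσ.2⟩)
  obtain ⟨W, ⟨hW, V, hV, hρ, hVW⟩, hxW⟩ := a.exists_mem_vaught_of_subset_sUnion
    (hc.mono fun W (hW : W ∈ T) => hW.1) hx' (by
      rintro σ ⟨hσ, hσU⟩ -
      obtain ⟨W, V, hW, hV, hσW, hρV, hWV⟩ := exists_isOpen_mul_mem hσ hU hσU
      obtain ⟨W', hW', hσW', hW'W⟩ := h𝓤.exists_subset_of_mem_open hσW hW
      exact ⟨W', ⟨hW', _, hV.preimage GroupoidArrow.continuous_inv, hρV,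
        fun σ' hσ' ρ' hρ' h => hWV σ' (hW'W hσ') _ hρ' h⟩, hσW'⟩)
  refine ⟨V, W, hV, h𝓤.isOpen hW, hρ, hxW, fun ρ' hρ' x' hx' h' => ?_⟩
  rw [act_mem_vaught_iff]
  exact fun hm => hx' (hm.of_forall_mem fun σ hσ => ⟨hVW _ hσ.1 ρ' hρ' _, hσ.2⟩)

/-- The finer topology `t` on the domain is taken to be the Vaught topology itself for the final
result and `generateFrom A` for the parametrisation by the core. -/
theorem continuous_act_vaughtTopology [t : TopologicalSpace X] {A : Set (Set X)}
    (ht : t ≤ a.vaughtTopology A) :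
    Continuous[_, a.vaughtTopology A] fun q : a.Domain => a.act q.1.1 q.1.2 q.2 := by
  refine continuous_generateFrom_iff.2 ?_
  rintro _ ⟨U, hU, B, hB, rfl⟩
  refine isOpen_iff_forall_mem_open.2 fun q hq => ?_
  obtain ⟨V, W, hV, hW, hqV, hqW, hVW⟩ := exists_isOpen_act_mem_vaught hU q.2 hq
  refine ⟨Subtype.val ⁻¹' (V ×ˢ a.vaught W B), fun q' hq' => ?_, ?_, hqV, hqW⟩
  · exact hVW _ hq'.1 _ hq'.2 q'.2
  · exact (hV.prod (ht _ (isOpen_vaught hW hB))).preimage continuous_subtype_val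

/-! ### The core. -/

variable (a) in
/-- The points that belong to `B` only if they belong to all Vaught transforms of `B` at
neighbourhoods of their unit. -/
def vaughtCore (𝓤 : Set (Set (Quiver.Total O))) (A : Set (Set X)) : Set X :=
  {x | ∀ B ∈ A, ∀ U ∈ 𝓤, unit (a.anchor x) ∈ U → x ∈ B → x ∈ a.vaught U B}

theorem isMeagre_act_notMem_vaughtCore {𝓤 : Set (Set (Quiver.Total O))} (hc : 𝓤.Countable)
    (h𝓤 : IsTopologicalBasis 𝓤) {A : Set (Set X)} (hA : A.Countable) (x : X) :
    IsMeagre {γ : Source (a.anchor x) | a.act γ.1 x γ.2 ∉ a.vaughtCore 𝓤 A} := by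
  have := hc.to_subtype
  have := hA.to_subtype
  -- `M B V` is `{γ ∈ V | γ x ∈ B}` if that set is meagre and empty otherwise. If `γ x` leaves the
  -- core, translating the failure back by `γ` puts `γ` in some `M B V`.
  let M : A → 𝓤 → Set (Source (a.anchor x)) := fun B V =>
    {γ | a.act γ.1 x γ.2 ∈ B.1 ∧ γ.1 ∈ V.1 ∧
      IsMeagre {σ : Source (a.anchor x) | σ.1 ∈ V.1 ∧ a.act σ.1 x σ.2 ∈ B.1}}
  have hM : ∀ B V, IsMeagre (M B V) := by
    intro B V
    by_cases h : IsMeagre {σ : Source (a.anchor x) | σ.1 ∈ V.1 ∧ a.act σ.1 x σ.2 ∈ B.1}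
    · exact h.of_forall_mem fun γ hγ => ⟨hγ.2.1, hγ.1⟩
    · exact IsMeagre.empty.of_forall_mem fun γ hγ => h hγ.2.2
  refine (isMeagre_iUnion fun B => isMeagre_iUnion fun V => hM B V).of_forall_mem fun γ hγ => ?_
  obtain ⟨B, hB, U, hU, hγU, hγB, hγn⟩ : ∃ B ∈ A, ∃ U ∈ 𝓤,
      unit (a.anchor (a.act γ.1 x γ.2)) ∈ U ∧ a.act γ.1 x γ.2 ∈ B ∧
        a.act γ.1 x γ.2 ∉ a.vaught U B := by
    by_contra! h
    exact hγ h
  rw [act_mem_vaught_iff, not_not] at hγn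
  have h1 : mul γ.1 (inv γ.1) (inv_right γ.1).symm ∈ U := by
    rw [GroupoidArrow.mul_inv, ← a.anchor_act γ.1 x γ.2]
    exact hγU
  obtain ⟨V, W, hV, -, hγV, hγW, hVW⟩ := exists_isOpen_mul_mem _ (h𝓤.isOpen hU) h1
  obtain ⟨V', hV', hγV', hV'V⟩ := h𝓤.exists_subset_of_mem_open hγV hV
  refine mem_iUnion.2 ⟨⟨B, hB⟩, mem_iUnion.2 ⟨⟨V', hV'⟩, hγB, hγV', ?_⟩⟩
  exact hγn.of_forall_mem fun σ hσ => ⟨hVW _ (hV'V hσ.1) _ hγW _, hσ.2⟩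

/-- Almost every `σ x` lies in the core, so a suitable `σ ∈ U⁻¹` gives `x = σ⁻¹ (σ x)`. Conversely,
a core point of `B` has non-meagrely many translates in `B` near its unit, and this is carried along
`γ`. -/
theorem mem_vaught_iff_exists_mem_vaughtCore {𝓤 : Set (Set (Quiver.Total O))} (hc : 𝓤.Countable)
    (h𝓤 : IsTopologicalBasis 𝓤) {A : Set (Set X)} (hA : A.Countable)
    {U : Set (Quiver.Total O)} (hU : IsOpen U) {B : Set X} (hB : B ∈ A) {x : X} :
    x ∈ a.vaught (inv ⁻¹' U) B ↔ ∃ γ ∈ U, ∃ y ∈ B ∩ a.vaughtCore 𝓤 A,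
      ∃ h : γ.left = a.anchor y, a.act γ y h = x := by
  constructor
  · intro hx
    by_contra! hn
    refine hx ((isMeagre_act_notMem_vaughtCore hc h𝓤 hA x).of_forall_mem fun σ hσ hσ' => ?_)
    exact hn (inv σ.1) hσ.1 _ ⟨hσ.2, hσ'⟩ _ (a.act_inv_act σ.2)
  · rintro ⟨γ, hγ, y, ⟨hyB, hy⟩, h, rfl⟩
    rw [act_mem_vaught_iff]
    have h1 : mul (unit (a.anchor y)) (inv γ) h.symm ∈ inv ⁻¹' U := by
      change inv (mul (unit (a.anchor y)) (inv γ) h.symm) ∈ U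
      rw [(unit_mul (inv γ) (a.anchor y) h.symm : mul _ _ h.symm = _), GroupoidArrow.inv_inv]
      exact hγ
    obtain ⟨V, W, hV, -, hyV, hγW, hVW⟩ :=
      exists_isOpen_mul_mem _ (hU.preimage GroupoidArrow.continuous_inv) h1
    obtain ⟨V', hV', hyV', hV'V⟩ := h𝓤.exists_subset_of_mem_open hyV hV
    exact fun hm => hy B hB V' hV' hyV' hyB
      (hm.of_forall_mem fun σ hσ => ⟨hVW _ (hV'V hσ.1) _ hγW _, hσ.2⟩)

variable [MeasurableSpace X] {𝓤 : Set (Set (Quiver.Total O))} {A : Set (Set X)}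

/-- Members of `A` are clopen in `generateFrom A`, so each failure of the core condition is open. -/
theorem IsVaughtAlgebra.isClosed_vaughtCore (hA : a.IsVaughtAlgebra 𝓤 A) (hc : 𝓤.Countable)
    (h𝓤 : IsTopologicalBasis 𝓤) : IsClosed[generateFrom A] (a.vaughtCore 𝓤 A) := by
  let := generateFrom A
  have hP : Continuous fun x => unit (a.anchor x) := continuous_le_dom (hA.generateFrom_le hc h𝓤)
    (continuous_anchor_vaughtTopology hA.univ_mem)
  have : a.vaughtCore 𝓤 A = ⋂ B ∈ A, ⋂ U ∈ 𝓤,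
      (((fun x => unit (a.anchor x)) ⁻¹' U ∩ B) ∩ (a.vaught U B)ᶜ)ᶜ := by
    ext x
    simp only [vaughtCore, mem_ofPred_eq, mem_iInter, mem_compl_iff, mem_inter_iff, mem_preimage]
    refine forall₂_congr fun B hB => forall₂_congr fun U hU => ?_
    tauto
  rw [this]
  refine isClosed_biInter fun B hB => isClosed_biInter fun U hU => IsOpen.isClosed_compl ?_
  exact (((h𝓤.isOpen hU).preimage hP).inter (isOpen_generateFrom_of_mem hB)).inter
    (isOpen_generateFrom_of_mem (hA.compl_mem _ (hA.vaught_mem U hU B hB)))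

/-! ### Separation, Polishness and Borel structure of the Vaught topology. -/

variable [MeasurableSpace (Quiver.Total O)] [BorelSpace (Quiver.Total O)]

/-- For inseparable `x` and `y`, the anchors agree and, for each `B ∈ A`, the `γ` with `γ x ∈ B` and
`γ y ∉ B` form a meagre set. Some `γ` avoids all these sets; as `A` separates points, `γ x = γ y`.
-/
theorem IsVaughtAlgebra.t0Space_vaughtTopology (hA : a.IsVaughtAlgebra 𝓤 A)
    (ha : a.IsBorelGSpace) (h𝓤 : IsTopologicalBasis 𝓤) : @T0Space X (a.vaughtTopology A) := by
  let := a.vaughtTopology A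
  refine ⟨fun x y hxy => ?_⟩
  have hP := continuous_anchor_vaughtTopology (a := a) hA.univ_mem
  have := PolishGroupoid.polish_objects (O := O)
  have hanchor : a.anchor x = a.anchor y := by
    have := (hxy.map (hP.subtype_mk fun z => mem_range_self (a.anchor z))).eq
    exact unit_injective (congrArg Subtype.val this)
  have hm : ∀ B ∈ A, IsMeagre {γ : Source (a.anchor x) |
      a.act γ.1 x γ.2 ∈ B ∧ a.act γ.1 y (γ.2.trans hanchor) ∉ B} := by
    intro B hB
    by_contra hn
    have hBm := hA.measurableSet B hB
    obtain ⟨V, hV, -, ⟨γ, hγ⟩, hmV⟩ := exists_mem_basis_isMeagre h𝓤 isOpen_univ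
      ((ha.measurableSet_act_mem rfl hBm).inter (ha.measurableSet_act_mem hanchor hBm).compl)
      (fun h => hn (h.of_forall_mem fun γ hγ => ⟨trivial, hγ⟩))
    have hy : y ∉ a.vaught V B := by
      rw [mem_vaught_iff_of_eq a hanchor, not_not]
      exact hmV.of_forall_mem fun σ hσ => ⟨hσ.1, fun h => h.2 hσ.2⟩
    rw [← hxy.mem_open_iff (isOpen_vaught (h𝓤.isOpen hV) hB), mem_vaught, not_not] at hy
    refine not_isMeagre_of_mem (h𝓤.isOpen hV) hγ ((hy.union hmV).of_forall_mem fun σ hσ => ?_)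
    by_cases h : a.act σ.1 x σ.2 ∈ B
    · exact Or.inl ⟨hσ, h⟩
    · exact Or.inr ⟨hσ, fun h' => h h'.1⟩
  have := hA.countable.to_subtype
  have hm' := isMeagre_iUnion fun B : A => hm B B.2
  obtain ⟨γ, hγ⟩ : ∃ γ : Source (a.anchor x), ∀ B ∈ A, a.act γ.1 x γ.2 ∈ B →
      a.act γ.1 y (γ.2.trans hanchor) ∈ B := by
    by_contra! h
    refine not_isMeagre_of_mem (U := univ) isOpen_univ (γ := ⟨unit (a.anchor x), rfl⟩) trivial
      (hm'.of_forall_mem fun γ _ => ?_)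
    obtain ⟨B, hB, h1, h2⟩ := h γ
    exact mem_iUnion.2 ⟨⟨B, hB⟩, h1, h2⟩
  refine a.act_injective γ.2 (γ.2.trans hanchor) ?_
  by_contra hne
  let := generateFrom A
  have := hA.polish
  obtain ⟨B, hB, h1, h2⟩ := hA.isTopologicalBasis.exists_subset_of_mem_open
    (mem_compl_singleton_iff.2 hne) isClosed_singleton.isOpen_compl
  exact h2 (hγ B hB h1) rfl

/-- Write `V*` for `(a.vaught V Bᶜ)ᶜ`, the points at which `B` is comeagre in `V`. For small `W`
around the unit and `V' ⊆ V` around `γ₀`, the open condition "`w y ∈ V*` for non-meagrely many `w ∈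
W`" implies the closed one "`w y ∈ V'*` for comeagrely many `w ∈ W`", because `V' w ⊆ V w'` for `w,
w' ∈ W`. The closed condition implies `y ∈ a.vaught U B`, because `V' w ⊆ V₀ ⊆ U`. -/
theorem IsVaughtAlgebra.regularSpace_vaughtTopology (hA : a.IsVaughtAlgebra 𝓤 A)
    (ha : a.IsBorelGSpace) (h𝓤 : IsTopologicalBasis 𝓤) :
    @RegularSpace X (a.vaughtTopology A) := by
  refine RegularSpace.of_generateFrom ?_
  rintro _ ⟨U, hU, B, hB, rfl⟩ x hx
  change ∃ t, t ∈ @nhds X (a.vaughtTopology A) x ∧ IsClosed[a.vaughtTopology A] t ∧ _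
  let := a.vaughtTopology A
  have hstar : ∀ V ∈ 𝓤, (a.vaught V Bᶜ)ᶜ ∈ A := fun V hV =>
    hA.compl_mem _ (hA.vaught_mem V hV _ (hA.compl_mem B hB))
  obtain ⟨V₀, hV₀, hV₀U, ⟨γ₀, hγ₀, hγ₀x⟩, hxV₀⟩ :=
    ha.exists_mem_basis_of_mem_vaught h𝓤 hU (hA.measurableSet B hB) hx
  have hmul : mul γ₀ (unit (a.anchor x)) hγ₀x = γ₀ := mul_unit _ _ _
  have hdiv : mul γ₀ (inv (unit (a.anchor x))) hγ₀x = γ₀ :=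
    (mul_congr rfl (inv_unit _) _).trans hmul
  obtain ⟨V₁, W₁, hV₁, hW₁, hγV₁, hxW₁, hVW₁⟩ :=
    exists_isOpen_mul_mem _ (h𝓤.isOpen hV₀) (hmul.symm ▸ hγ₀)
  obtain ⟨V, hV, hγV, hVV₁⟩ := h𝓤.exists_subset_of_mem_open hγV₁ hV₁
  obtain ⟨V₃, W₃, hV₃, hW₃, hγV₃, hxW₃, hVW₃⟩ :=
    exists_isOpen_mul_mem _ (h𝓤.isOpen hV) (hdiv.symm ▸ hγV)
  obtain ⟨V₂, W₂, hV₂, hW₂, hγV₂, hxW₂, hVW₂⟩ :=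
    exists_isOpen_mul_mem _ hV₃ (hmul.symm ▸ hγV₃)
  obtain ⟨V', hV', hγV', hV'V⟩ := h𝓤.exists_subset_of_mem_open
    (show γ₀ ∈ V₂ ∩ V from ⟨hγV₂, hγV⟩) (hV₂.inter (h𝓤.isOpen hV))
  -- `R`, and later `S` with `K`, rule out vacuous comeagreness: `V'` meets the fibre over `r(w)`
  -- for `w ∈ W`, and `W` meets the fibre over each anchor in `K`.
  obtain ⟨R, hR, hRV'⟩ := exists_isOpen_unit_mem_iff (h𝓤.isOpen hV')
  let W := W₁ ∩ W₂ ∩ (inv ⁻¹' W₃) ∩ (fun γ => unit γ.right) ⁻¹' R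
  have hW : IsOpen W := ((hW₁.inter hW₂).inter (hW₃.preimage GroupoidArrow.continuous_inv)).inter
    (hR.preimage continuous_unit_right)
  have hxW : unit (a.anchor x) ∈ W :=
    ⟨⟨⟨hxW₁, hxW₂⟩, hxW₃⟩, (hRV' _).2 ⟨γ₀, hγV', hγ₀x⟩⟩
  obtain ⟨S, hS, hSW⟩ := exists_isOpen_unit_mem_iff hW
  have hP : Continuous fun y => (⟨unit (a.anchor y), mem_range_self _⟩ : range (unit (O := O))) :=
    (continuous_anchor_vaughtTopology (a := a) hA.univ_mem).subtype_mk _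
  have := PolishGroupoid.polish_objects (O := O)
  obtain ⟨K, hK, hKc, hKS⟩ := exists_mem_nhds_isClosed_subset
    ((hS.preimage continuous_subtype_val).mem_nhds
      (show (⟨unit (a.anchor x), mem_range_self _⟩ : range (unit (O := O))) ∈ Subtype.val ⁻¹' S
        from (hSW _).2 ⟨_, hxW, rfl⟩))
  refine ⟨(a.vaught W (a.vaught V' Bᶜ)ᶜᶜ)ᶜ ∩
    (fun y => (⟨unit (a.anchor y), mem_range_self _⟩ : range (unit (O := O)))) ⁻¹' K, ?_, ?_, ?_⟩
  · have hxN : x ∈ a.vaught W (a.vaught V Bᶜ)ᶜ := by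
      refine fun hm => not_isMeagre_of_mem hW (γ := ⟨unit (a.anchor x), rfl⟩) hxW
        (hm.of_forall_mem fun w hw => ⟨hw, fun h => ?_⟩)
      rw [act_mem_vaught_iff] at h
      refine h ((not_not.1 hxV₀).of_forall_mem fun σ hσ => ⟨?_, hσ.2⟩)
      exact mem_of_mul_inv_mem hVW₁ _ (hVV₁ hσ.1) hw.1.1.1
    filter_upwards [(isOpen_vaught hW (hstar V hV)).mem_nhds hxN,
      hP.continuousAt.preimage_mem_nhds hK] with y hy hyK
    refine ⟨?_, hyK⟩
    obtain ⟨w', hw'W, hw'⟩ := nonempty_of_not_isMeagre hy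
    rw [mem_compl_iff, act_mem_vaught_iff, not_not] at hw'
    refine not_not.2 (IsMeagre.empty.of_forall_mem fun w hw => ?_)
    have h2 := not_not.1 hw.2
    rw [act_mem_vaught_iff] at h2
    refine h2 (hw'.of_forall_mem fun σ hσ => ⟨?_, hσ.2⟩)
    exact hVW₃ _ (mem_of_mul_inv_mem hVW₂ _ (hV'V hσ.1).1 hw.1.1.1.2) _ hw'W.1.2 _
  · refine IsClosed.inter ?_ (hKc.preimage hP)
    exact (isOpen_vaught hW (hA.compl_mem _ (hstar V' hV'))).isClosed_compl
  · rintro y ⟨hyC, hyK⟩ hyU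
    obtain ⟨w₀, hw₀, hw₀y⟩ := (hSW _).1 (hKS hyK)
    obtain ⟨w, hwW, hw⟩ : ∃ w : Source (a.anchor y), w.1 ∈ W ∧
        a.act w.1 y w.2 ∉ a.vaught V' Bᶜ := by
      by_contra! h
      exact hyC fun hm => not_isMeagre_of_mem hW (γ := ⟨w₀, hw₀y⟩) hw₀
        (hm.of_forall_mem fun w hw => ⟨hw, not_not.2 (h w hw)⟩)
    have hne : a.act w.1 y w.2 ∈ a.vaught V' univ := by
      rw [mem_vaught_univ_iff a (h𝓤.isOpen hV'), a.anchor_act]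
      exact (hRV' _).1 hwW.2
    rw [act_mem_vaught_iff] at hne hw
    refine hne (((not_not.1 hw).union hyU).of_forall_mem fun σ hσ => ?_)
    by_cases h : a.act σ.1 y σ.2 ∈ B
    · exact Or.inr ⟨hV₀U (mem_of_mul_inv_mem hVW₁ _ (hVV₁ (hV'V hσ.1).2) hwW.1.1.1), h⟩
    · exact Or.inl ⟨hσ.1, h⟩

theorem IsVaughtAlgebra.polishSpace_vaughtTopology (hA : a.IsVaughtAlgebra 𝓤 A)
    (ha : a.IsBorelGSpace) (hc : 𝓤.Countable) (h𝓤 : IsTopologicalBasis 𝓤)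
    (hpol : ∀ U ∈ 𝓤, PolishSpace U) : @PolishSpace X (a.vaughtTopology A) := by
  have hreg := hA.regularSpace_vaughtTopology ha h𝓤
  have hT0 := hA.t0Space_vaughtTopology ha h𝓤
  let t' := generateFrom A
  have ht' : PolishSpace X := hA.polish
  have hle : t' ≤ a.vaughtTopology A := hA.generateFrom_le hc h𝓤
  have hcore : PolishSpace (a.vaughtCore 𝓤 A) := (hA.isClosed_vaughtCore hc h𝓤).polishSpace
  have := hc.to_subtype
  have : ∀ V : 𝓤, PolishSpace V.1 := fun V => hpol V V.2
  have := PolishGroupoid.polish_objects (O := O)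
  -- `G` itself may fail to be Hausdorff; the disjoint union of its basic sets is Polish and covers
  -- it.
  let G' := Σ V : 𝓤, V.1
  have hG' : PolishSpace G' := {}
  have hG'c : Continuous fun g : G' => g.2.1 :=
    continuous_sigma fun V => continuous_subtype_val
  let D : Set (G' × a.vaughtCore 𝓤 A) := {q | q.1.2.1.left = a.anchor q.2}
  have hD : IsClosed D := by
    have h1 : Continuous fun q : G' × a.vaughtCore 𝓤 A =>
        (⟨unit q.1.2.1.left, mem_range_self _⟩ : range (unit (O := O))) :=
      (continuous_unit_left.comp (hG'c.comp continuous_fst)).subtype_mk _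
    have h2 : Continuous fun q : G' × a.vaughtCore 𝓤 A =>
        (⟨unit (a.anchor q.2), mem_range_self _⟩ : range (unit (O := O))) :=
      ((continuous_le_dom hle (continuous_anchor_vaughtTopology hA.univ_mem)).comp
        (continuous_subtype_val.comp continuous_snd)).subtype_mk _
    convert isClosed_eq h1 h2 using 1
    ext q
    exact ⟨fun h => Subtype.ext (congrArg unit h),
      fun h => unit_injective (congrArg Subtype.val h)⟩
  have hDp : PolishSpace D := hD.polishSpace
  let f : D → X := fun q => a.act q.1.1.2.1 q.1.2 q.2
  have hf : Continuous[_, a.vaughtTopology A] f := by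
    have h1 : Continuous fun q : D => (⟨(q.1.1.2.1, q.1.2.1), q.2⟩ : a.Domain) :=
      ((hG'c.comp (continuous_fst.comp continuous_subtype_val)).prodMk
        (continuous_subtype_val.comp (continuous_snd.comp continuous_subtype_val))).subtype_mk _
    exact @Continuous.comp _ _ _ _ _ (a.vaughtTopology A) _ _
      (continuous_act_vaughtTopology hle) h1
  have hfs : Function.Surjective f := by
    intro x
    have hx : x ∈ a.vaught (inv ⁻¹' univ) univ :=
      (mem_vaught_univ_iff a isOpen_univ).2 ⟨unit (a.anchor x), trivial, rfl⟩
    obtain ⟨γ, -, y, ⟨-, hy⟩, h, hx⟩ := (mem_vaught_iff_exists_mem_vaughtCore hc h𝓤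
      hA.countable isOpen_univ hA.univ_mem).1 hx
    obtain ⟨V, hV, hγ, -⟩ := h𝓤.exists_subset_of_mem_open (mem_univ γ) isOpen_univ
    exact ⟨⟨(⟨⟨V, hV⟩, ⟨γ, hγ⟩⟩, ⟨y, hy⟩), h⟩, hx⟩
  -- A basic piece of `D` maps onto `U · (B ∩ vaughtCore)`, which is a Vaught transform.
  have hfo : @IsOpenMap _ _ _ (a.vaughtTopology A) f := by
    intro W hW
    refine (@isOpen_iff_forall_mem_open X (a.vaughtTopology A) _).2 ?_
    rintro _ ⟨⟨⟨⟨V, g⟩, c⟩, hgc⟩, hqW, rfl⟩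
    obtain ⟨W₀, hW₀, rfl⟩ := isOpen_induced_iff.1 hW
    obtain ⟨S, T, hS, hT, hgS, hcT, hST⟩ := isOpen_prod_iff.1 hW₀ _ _ hqW
    obtain ⟨T₀, hT₀, rfl⟩ := isOpen_induced_iff.1 hT
    obtain ⟨S₀, hS₀, hS₀S⟩ := isOpen_induced_iff.1 (isOpen_sigma_iff.1 hS V)
    obtain ⟨B, hB, hcB, hBT₀⟩ := hA.isTopologicalBasis.exists_subset_of_mem_open hcT hT₀
    have hgS₀ : g ∈ Subtype.val ⁻¹' S₀ := hS₀S ▸ hgS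
    have hU : IsOpen (S₀ ∩ V.1) := hS₀.inter (h𝓤.isOpen V.2)
    have key := fun x => mem_vaught_iff_exists_mem_vaughtCore (a := a) hc h𝓤 hA.countable hU hB
      (x := x)
    refine ⟨a.vaught (inv ⁻¹' (S₀ ∩ V.1)) B, ?_,
      isOpen_vaught (hU.preimage GroupoidArrow.continuous_inv) hB,
      (key _).2 ⟨g.1, ⟨hgS₀, g.2⟩, c.1, ⟨hcB, c.2⟩, hgc, rfl⟩⟩
    intro x hx
    obtain ⟨γ, ⟨hγS, hγV⟩, y, ⟨hyB, hy⟩, h, rfl⟩ := (key x).1 hx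
    refine ⟨⟨(⟨V, ⟨γ, hγV⟩⟩, ⟨y, hy⟩), h⟩, hST ⟨?_, hBT₀ hyB⟩, rfl⟩
    have : (⟨γ, hγV⟩ : V.1) ∈ Subtype.val ⁻¹' S₀ := hγS
    rw [hS₀S] at this
    exact this
  exact @PolishSpace.of_isOpenMap D X _ hDp (a.vaughtTopology A) hreg hT0 f hf hfo hfs

theorem IsVaughtAlgebra.borelSpace_vaughtTopology (hA : a.IsVaughtAlgebra 𝓤 A)
    (ha : a.IsBorelGSpace) (hc : 𝓤.Countable) (h𝓤 : IsTopologicalBasis 𝓤)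
    (hpol : ∀ U ∈ 𝓤, PolishSpace U) : @BorelSpace X (a.vaughtTopology A) _ := by
  have := ha.standardBorel
  have := hA.polishSpace_vaughtTopology ha hc h𝓤 hpol
  let := a.vaughtTopology A
  have hle : borel X ≤ ‹MeasurableSpace X› := by
    rw [borel_eq_generateFrom_of_subbasis (rfl : a.vaughtTopology A = _)]
    refine MeasurableSpace.generateFrom_le ?_
    rintro _ ⟨U, hU, B, hB, rfl⟩
    exact ha.measurableSet_vaught hU (hA.measurableSet B hB)
  have : OpensMeasurableSpace X := ⟨hle⟩
  -- Lusin–Souslin: the identity is a measurable surjection from a standard Borel space, so it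
  -- induces the Borel structure of the Vaught topology.
  have := (measurable_id (α := X)).map_measurableSpace_eq_borel Function.surjective_id
  rw [MeasurableSpace.map_id] at this
  exact ⟨this⟩

/-- A Borel `G`-space has a compatible Polish topology for which the action is continuous. -/
theorem IsBorelGSpace.exists_isPolishGSpace (ha : a.IsBorelGSpace) :
    ∃ _ : TopologicalSpace X, BorelSpace X ∧ a.IsPolishGSpace := by
  obtain ⟨𝓤, hc, h𝓤, hpol⟩ := PolishGroupoid.locallyPolish (O := O)
  obtain ⟨A, hA⟩ := ha.exists_isVaughtAlgebra hc fun U hU => h𝓤.isOpen hU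
  let := a.vaughtTopology A
  exact ⟨this, hA.borelSpace_vaughtTopology ha hc h𝓤 hpol,
    hA.polishSpace_vaughtTopology ha hc h𝓤 hpol,
    continuous_anchor_vaughtTopology hA.univ_mem, continuous_act_vaughtTopology le_rfl⟩

end GroupoidAction

theorem mainTheorem5 {O : Type u} [Groupoid.{v} O]
    [TopologicalSpace (Quiver.Total O)] [PolishGroupoid O]
    [MeasurableSpace (Quiver.Total O)] [BorelSpace (Quiver.Total O)]
    {X : Type w} [MeasurableSpace X] (a : GroupoidAction O X) (ha : a.IsBorelGSpace) :
    (∃ (Y : Type w) (_ : TopologicalSpace Y) (_ : MeasurableSpace Y) (_ : BorelSpace Y)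
        (b : GroupoidAction O Y), b.IsPolishGSpace ∧ ∃ φ : X → Y, a.IsBorelGIso b φ) ∧
      (∃ (_ : TopologicalSpace X), BorelSpace X ∧ a.IsPolishGSpace) := by
  obtain ⟨t, hb, hp⟩ := ha.exists_isPolishGSpace
  exact ⟨⟨X, t, _, hb, a, hp, id, measurable_id, fun _ => rfl, fun _ _ _ => rfl,
    Function.bijective_id⟩, t, hb, hp⟩
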